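/- Let $J$ be a finite set of resources with capacities $C_j>0$ and $I$ a finite set of flow types, where type $i$ can use the resources in a nonempty set $J(i)\subseteq J$ (routes of length one). For $J'\subseteq J$ put $C(J')=\sum_{j\in J'}C_j$ and $I(J')=\{i\in I: J(i)\subseteq J'\}$. A nonempty $J'\subseteq J$ is strongly connected if there are no partition of $J'$ into nonempty sets $J_1,J_2$ and partition of $I(J')$ into (possibly empty) sets $I_1,I_2$ with $J(i)\cap J_2=\emptyset$ for $i\in I_1$ and $J(i)\cap J_1=\emptyset$ for $i\in I_2$. Let $U:(0,\infty)\to\mathbb R$ be strictly concave, strictly increasing and differentiable, with $U(0):=\lim_{x\downarrow0}U(x)\in[-\infty,\infty)$. For $N\in\mathbb R_{\ge0}^I$, a rate allocation $x(N)$ is a maximizer of $\sum_{i}N_iU(x_i)$ over all $x$ for which there are $x_i^j\ge0$ ($j\in J(i)$) with $x_i=\sum_{j\in J(i)}x_i^j$ for all $i\in I$ and $\sum_{i:j\in J(i)}N_ix_i^j\le C_j$ for all $j\in J$, where $x_i=0$ if $N_i=0$ and $0\cdot(-\infty)=0$. The state $N$ is in complete resource pooling if, for all $N'$ in some neighbourhood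 of $N$ in $\mathbb R_{\ge0}^I$, the rate allocation $x(N')$ exists, is unique, and satisfies $x_i(N')=C(J)/\sum_{i'\in I}N'_{i'}$ for all $i\in I$. In the integrated streaming and elastic model with parameters $\lambda_i\ge0$ and $\mu_i,\kappa_i,\eta_i>0$, put $\rho_i=\lambda_i/\mu_i$. An equilibrium point is a pair $(\hat n,\hat m)$ of vectors in $\mathbb R_{\ge0}^I$ (elastic and streaming flows) that is stationary for the fluid limit $$n_i'=\lambda_i-\mu_in_i\,x_i(n+m),\qquad m_i'=\kappa_i-\eta_im_i .$$ Assume the stability condition $\sum_{i\in I(J')}\rho_i<C(J')$ for all strongly connected $J'\subseteq J$. If $$\sum_{i\in I\setminus I(J\setminus J')}\rho_i>C(J')\qquad\text{for every nonempty } J'\subseteq J \text{ such that } J\setminus J' \text{ is strongly connected},$$ then there is a unique equilibrium point $(\hat n,\hat m)$, and the state $\hat n+\hat m$ is in complete resource pooling. -/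

import Mathlib

open Filter Topology

/-- A multipath network with routes of length one: resources `J` with positive capacities, flow
types `I`, and for each flow type the nonempty set `access i = J(i)` of resources it can use. -/
structure PoolNetwork (I J : Type*) where
  cap : J → ℝ
  access : I → Finset J
  cap_pos : ∀ j, 0 < cap j
  access_nonempty : ∀ i, (access i).Nonempty

namespace PoolNetwork

variable {I J : Type*} [Fintype I] [DecidableEq I] [Fintype J] [DecidableEq J]

/-- `C(J')`, the total capacity of a set of resources. -/
def capacity (N : PoolNetwork I J) (J' : Finset J) : ℝ := ∑ j ∈ J', N.cap j

/-- `I(J')`, the flow types all of whose resources lie in `J'`. -/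
def captive (N : PoolNetwork I J) (J' : Finset J) : Finset I :=
  {i | N.access i ⊆ J'}

/-- The pair `(I', J')` is connected: `J'` has no partition into nonempty `J₁`, `J₂` for which `I'`
has a partition into (possibly empty) `I₁`, `I₂` such that no type in `I₁` can use `J₂` and no type
in `I₂` can use `J₁`. -/
def PairConnected (N : PoolNetwork I J) (I' : Finset I) (J' : Finset J) : Prop :=
  ¬ ∃ J₁ J₂ : Finset J, J₁.Nonempty ∧ J₂.Nonempty ∧ Disjoint J₁ J₂ ∧ J₁ ∪ J₂ = J' ∧
    ∃ I₁ I₂ : Finset I, Disjoint I₁ I₂ ∧ I₁ ∪ I₂ = I' ∧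
      (∀ i ∈ I₁, Disjoint (N.access i) J₂) ∧ (∀ i ∈ I₂, Disjoint (N.access i) J₁)

/-- `J'` is a (nonempty) strongly connected set of resources: `(I(J'), J')` is connected. -/
def StronglyConnected (N : PoolNetwork I J) (J' : Finset J) : Prop :=
  J'.Nonempty ∧ N.PairConnected (N.captive J') J'

/-- With `n i` flows of type `i`, the vector `x` of per-flow rates is feasible if each `x i` splits
into nonnegative rates `y i j`, supported on `j ∈ J(i)`, that respect the capacities. -/
def Feasible (N : PoolNetwork I J) (n x : I → ℝ) : Prop :=
  ∃ y : I → J → ℝ,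
    (∀ i j, 0 ≤ y i j) ∧
    (∀ i j, j ∉ N.access i → y i j = 0) ∧
    (∀ i, ∑ j ∈ N.access i, y i j = x i) ∧
    (∀ j, ∑ i, n i * y i j ≤ N.cap j)

/-- A utility function on `(0, ∞)`, extended to `0` by its right limit (an infimum, as utilities are
increasing), which may be `-∞`: this is the case for the logarithm and for `x ^ (1 - α) / (1 - α)`,
`α > 1`. -/
noncomputable def extUtility (U : ℝ → ℝ) (x : ℝ) : EReal :=
  if 0 < x then (U x : EReal) else ⨅ y : Set.Ioi (0 : ℝ), (U y : EReal)

/-- The objective `∑ i, n i * U (x i)`. In `EReal`, `0 * ⊥ = 0`: absent types do not contribute. -/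
noncomputable def totalUtility (U : ℝ → ℝ) (n x : I → ℝ) : EReal :=
  ∑ i, (n i : EReal) * extUtility U (x i)

/-- `x` is an optimal rate allocation for the flow numbers `n`, with the convention that `x i = 0`
if no flows of type `i` are present. -/
def IsRateAllocation (N : PoolNetwork I J) (U : ℝ → ℝ) (n x : I → ℝ) : Prop :=
  N.Feasible n x ∧ (∀ i, n i = 0 → x i = 0) ∧
    ∀ x', N.Feasible n x' → totalUtility U n x' ≤ totalUtility U n x

/-- The state `n` is in complete resource pooling: for all states `n'` in a neighbourhood of `n`
(in the set of nonnegative vectors), the optimal rate allocation exists, is unique, and gives every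
flow the rate `C(J) / ∑ i, n' i`. -/
def CompleteResourcePooling (N : PoolNetwork I J) (U : ℝ → ℝ) (n : I → ℝ) : Prop :=
  ∀ᶠ n' in 𝓝[{v : I → ℝ | ∀ i, 0 ≤ v i}] n, ∀ x : I → ℝ,
    N.IsRateAllocation U n' x ↔ x = fun _ => N.capacity Finset.univ / ∑ i, n' i

/-- `(n, m)` (numbers of elastic and of streaming flows) is an equilibrium point of the fluid limit
`nᵢ' = lamᵢ - μᵢ nᵢ xᵢ(n, m)`, `mᵢ' = κᵢ - ηᵢ mᵢ` of the integrated model. Elastic and streaming flows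
are treated alike in the rate allocation, which is the one for the flow numbers `n + m`. -/
def IsEquilibrium (N : PoolNetwork I J) (U : ℝ → ℝ) (lam μ κ η : I → ℝ) (n m : I → ℝ) : Prop :=
  (∀ i, 0 ≤ n i) ∧ (∀ i, 0 ≤ m i) ∧
    ∃ x : I → ℝ, N.IsRateAllocation U (n + m) x ∧
      (∀ i, lam i - μ i * n i * x i = 0) ∧ (∀ i, κ i - η i * m i = 0)

/-- The stability condition: `∑ i ∈ I(J'), ρ i < C(J')` for all strongly connected `J'`. -/
def Stable (N : PoolNetwork I J) (ρ : I → ℝ) : Prop :=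
  ∀ J' : Finset J, N.StronglyConnected J' → ∑ i ∈ N.captive J', ρ i < N.capacity J'

end PoolNetwork

set_option linter.unusedSectionVars false

namespace PoolNetwork

variable {I J : Type*} [Fintype I] [DecidableEq I] [Fintype J] [DecidableEq J]

/-! The key quantity is the slack of a set of resources. It is additive over the two pieces of a
disconnected set, so strong induction extends both hypotheses beyond strongly connected sets:
stability makes every nonempty set have positive slack (`Stable.slack_pos`), and the pooling
hypothesis makes every proper nonempty set have more slack than the whole network
(`Stable.slack_univ_lt`).

Write `δ` for the slack of the whole network and `M` for the total of the streaming numbers `m`,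
which stationarity fixes. If all flows get a common rate `a` and the capacity is exhausted,
subtracting `∑ n i * x i = ∑ ρ i` from the total capacity leaves `M * a = δ`, whence `n i = ρ i * M
/ δ` (`balancedFlows`). At this state the types captive to a proper nonempty `K` carry at most their
`ρ`-load plus `δ`, which is less than the capacity of `K`. This strict inequality survives small
perturbations, so the transport theorem `exists_splitting_le_cap` keeps the uniform rate feasible
nearby, and strict concavity makes it the only optimum.

For uniqueness, let `A` be the types of maximal rate in an equilibrium allocation and `L` the
resources open to the other types. By an exchange argument (`IsRateAllocation.le_of_uses`) `A` does
not use `L`, so the `ρ`-load of `A` fits into the complement of `L`. Were `L` nonempty, it would be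
a proper set with at most the slack of the network. Hence the rates are uniform. -/

/-! ### Slack of sets of resources -/

/-- The capacity of `K` that is left over by the load `ρ` of the types captive to `K`. -/
def slack (N : PoolNetwork I J) (ρ : I → ℝ) (K : Finset J) : ℝ :=
  N.capacity K - ∑ i ∈ N.captive K, ρ i

lemma mem_captive {N : PoolNetwork I J} {K : Finset J} {i : I} :
    i ∈ N.captive K ↔ N.access i ⊆ K := by
  simp [captive]

lemma captive_univ (N : PoolNetwork I J) : N.captive Finset.univ = Finset.univ := by
  ext i; simp [mem_captive]

lemma capacity_add_compl (N : PoolNetwork I J) (K : Finset J) :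
    N.capacity K + N.capacity Kᶜ = N.capacity Finset.univ :=
  Finset.sum_add_sum_compl K N.cap

/-- The two parts of the types are exactly the types captive to the two parts of the resources:
since every type has some resource, a type on one side cannot be captive to the other. -/
lemma exists_slack_eq_add (N : PoolNetwork I J) (ρ : I → ℝ) {K : Finset J}
    (h : ¬ N.PairConnected (N.captive K) K) :
    ∃ J₁ J₂ : Finset J, J₁.Nonempty ∧ J₂.Nonempty ∧ J₁ ⊂ K ∧ J₂ ⊂ K ∧
      N.slack ρ K = N.slack ρ J₁ + N.slack ρ J₂ := by
  obtain ⟨J₁, J₂, h₁, h₂, hd, hu, I₁, I₂, hId, hIu, hI₁, hI₂⟩ := not_not.mp h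
  have e₁ : N.captive J₁ = I₁ := by
    ext i
    refine ⟨fun hi => ?_, fun hi => ?_⟩
    · rw [mem_captive] at hi
      have hiK : i ∈ I₁ ∪ I₂ := by
        rw [hIu, mem_captive, ← hu]
        exact hi.trans Finset.subset_union_left
      rcases Finset.mem_union.mp hiK with h' | h'
      · exact h'
      · have := hI₂ i h'
        exact absurd (Finset.disjoint_of_subset_right hi this)
          (by simpa using (N.access_nonempty i).ne_empty)
    · have hiK : i ∈ N.captive K := hIu ▸ Finset.mem_union_left _ hi
      rw [mem_captive, ← hu] at hiK
      rw [mem_captive]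
      intro j hj
      rcases Finset.mem_union.mp (hiK hj) with h' | h'
      · exact h'
      · exact absurd h' (Finset.disjoint_left.mp (hI₁ i hi) hj)
  have e₂ : N.captive J₂ = I₂ := by
    ext i
    refine ⟨fun hi => ?_, fun hi => ?_⟩
    · rw [mem_captive] at hi
      have hiK : i ∈ I₁ ∪ I₂ := by
        rw [hIu, mem_captive, ← hu]
        exact hi.trans Finset.subset_union_right
      rcases Finset.mem_union.mp hiK with h' | h'
      · have := hI₁ i h'
        exact absurd (Finset.disjoint_of_subset_right hi this)
          (by simpa using (N.access_nonempty i).ne_empty)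
      · exact h'
    · have hiK : i ∈ N.captive K := hIu ▸ Finset.mem_union_right _ hi
      rw [mem_captive, ← hu] at hiK
      rw [mem_captive]
      intro j hj
      rcases Finset.mem_union.mp (hiK hj) with h' | h'
      · exact absurd h' (Finset.disjoint_left.mp (hI₂ i hi) hj)
      · exact h'
  refine ⟨J₁, J₂, h₁, h₂, ?_, ?_, ?_⟩
  · refine Finset.ssubset_iff_subset_ne.mpr ⟨hu ▸ Finset.subset_union_left, fun he => ?_⟩
    obtain ⟨j, hj⟩ := h₂
    exact Finset.disjoint_right.mp hd hj (he ▸ hu ▸ Finset.mem_union_right _ hj)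
  · refine Finset.ssubset_iff_subset_ne.mpr ⟨hu ▸ Finset.subset_union_right, fun he => ?_⟩
    obtain ⟨j, hj⟩ := h₁
    exact Finset.disjoint_left.mp hd hj (he ▸ hu ▸ Finset.mem_union_left _ hj)
  · rw [slack, slack, slack, e₁, e₂, ← hIu, Finset.sum_union hId, capacity, ← hu,
      Finset.sum_union hd, capacity, capacity]
    ring

lemma Stable.slack_pos {N : PoolNetwork I J} {ρ : I → ℝ} (hs : N.Stable ρ) (K : Finset J)
    (hK : K.Nonempty) : 0 < N.slack ρ K := by
  induction K using Finset.strongInduction with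
  | H K ih =>
    by_cases hc : N.PairConnected (N.captive K) K
    · exact sub_pos.mpr (hs K ⟨hK, hc⟩)
    · obtain ⟨J₁, J₂, h₁, h₂, hs₁, hs₂, he⟩ := N.exists_slack_eq_add ρ hc
      rw [he]
      exact add_pos (ih J₁ hs₁ h₁) (ih J₂ hs₂ h₂)

lemma Stable.slack_univ_lt {N : PoolNetwork I J} {ρ : I → ℝ} (hs : N.Stable ρ)
    (hpool : ∀ J' : Finset J, J'.Nonempty → N.StronglyConnected J'ᶜ →
      N.capacity J' < ∑ i ∈ (N.captive J'ᶜ)ᶜ, ρ i)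
    (K : Finset J) (hK : K.Nonempty) (hne : K ≠ Finset.univ) :
    N.slack ρ Finset.univ < N.slack ρ K := by
  induction K using Finset.strongInduction with
  | H K ih =>
    by_cases hc : N.PairConnected (N.captive K) K
    -- For connected `K`, the pooling hypothesis for `Kᶜ` is the claim after adding capacity and
    -- load of the complements.
    · have h := hpool Kᶜ (by simpa [Finset.nonempty_iff_ne_empty] using hne)
        (by rw [compl_compl]; exact ⟨hK, hc⟩)
      rw [compl_compl] at h
      have h₁ := N.capacity_add_compl K
      have h₂ := Finset.sum_add_sum_compl (N.captive K) ρ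
      rw [slack, slack, captive_univ]
      linarith
    · obtain ⟨J₁, J₂, h₁, h₂, hs₁, hs₂, he⟩ := N.exists_slack_eq_add ρ hc
      have hJ₁ : J₁ ≠ Finset.univ := fun h =>
        (Finset.ssubset_univ_iff.mpr hne).not_subset (h ▸ hs₁.subset)
      rw [he]
      linarith [ih J₁ hs₁ h₁ hJ₁, hs.slack_pos J₂ h₂]

/-! ### Transport of demands to resources -/

/-- The splittings of the demands `d` over the accessible resources, without regard to capacities. -/
def splittings (N : PoolNetwork I J) (d : I → ℝ) : Set (I → J → ℝ) :=
  {z | (∀ i j, 0 ≤ z i j) ∧ (∀ i j, j ∉ N.access i → z i j = 0) ∧ ∀ i, ∑ j, z i j = d i}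

lemma isCompact_splittings (N : PoolNetwork I J) (d : I → ℝ) : IsCompact (N.splittings d) := by
  refine IsCompact.of_isClosed_subset (isCompact_Icc (a := (0 : I → J → ℝ))
    (b := fun i _ => d i)) ?_ ?_
  · simp only [splittings, Set.ofPred_and, Set.ofPred_forall]
    refine IsClosed.inter ?_ (IsClosed.inter ?_ ?_)
    · exact isClosed_iInter fun i => isClosed_iInter fun j =>
        isClosed_le continuous_const (by fun_prop)
    · exact isClosed_iInter fun i => isClosed_iInter fun j => isClosed_iInter fun _ =>
        isClosed_eq (by fun_prop) continuous_const
    · exact isClosed_iInter fun i => isClosed_eq (by fun_prop) continuous_const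
  · rintro z ⟨h0, -, hs⟩
    refine ⟨fun i j => h0 i j, fun i j => ?_⟩
    exact (Finset.single_le_sum (f := z i) (fun j _ => h0 i j) (Finset.mem_univ j)).trans_eq (hs i)

lemma splittings_nonempty (N : PoolNetwork I J) {d : I → ℝ} (hd : ∀ i, 0 ≤ d i) :
    (N.splittings d).Nonempty := by
  choose s hs using N.access_nonempty
  refine ⟨fun i => Pi.single (s i) (d i), fun i j => ?_, fun i j hj => ?_, fun i => ?_⟩
  · by_cases h : j = s i
    · subst h; simpa using hd i
    · simp [h]
  · have h : j ≠ s i := fun h => hj (h ▸ hs i)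
    simp [h]
  · simp

/-- Adding `t` to the `j'`-share and subtracting it from the `j`-share of row `i`. -/
def shift (z : I → J → ℝ) (i : I) (j j' : J) (t : ℝ) : I → J → ℝ :=
  Function.update z i fun k =>
    z i k + t * ((Pi.single j' (1 : ℝ) : J → ℝ) k - (Pi.single j (1 : ℝ) : J → ℝ) k)

lemma shift_nonneg {I J : Type*} [DecidableEq I] [DecidableEq J] {z : I → J → ℝ}
    (hz : ∀ a k, 0 ≤ z a k) {i : I} {j j' : J} {t : ℝ} (ht : 0 ≤ t) (htz : t ≤ z i j)
    (a : I) (k : J) : 0 ≤ shift z i j j' t a k := by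
  rcases eq_or_ne a i with rfl | ha
  · have h₀ := hz a k
    have hk : k = j → t ≤ z a k := by rintro rfl; exact htz
    simp only [shift, Function.update_self, Pi.single_apply]
    split_ifs with h₁ h₂ h₂
    · linarith
    · linarith
    · linarith [hk h₂]
    · linarith
  · simpa [shift, ha] using hz a k

lemma shift_mem_splittings {N : PoolNetwork I J} {d : I → ℝ} {z : I → J → ℝ}
    (hz : z ∈ N.splittings d) {i : I} {j j' : J} (hj : j ∈ N.access i) (hj' : j' ∈ N.access i)
    {t : ℝ} (ht : 0 ≤ t) (htz : t ≤ z i j) : shift z i j j' t ∈ N.splittings d := by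
  obtain ⟨h0, hs, hd⟩ := hz
  refine ⟨fun a k => ?_, fun a k hk => ?_, fun a => ?_⟩
  · exact shift_nonneg h0 ht htz a k
  · rcases eq_or_ne a i with rfl | ha
    · have h₁ : k ≠ j := fun h => hk (h ▸ hj)
      have h₂ : k ≠ j' := fun h => hk (h ▸ hj')
      simp [shift, h₁, h₂, hs a k hk]
    · simpa [shift, ha] using hs a k hk
  · rcases eq_or_ne a i with rfl | ha
    · simp [shift, Finset.sum_add_distrib, ← Finset.mul_sum, Finset.sum_sub_distrib, hd]
    · simpa [shift, ha] using hd a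

lemma sum_shift (z : I → J → ℝ) (i : I) (j j' : J) (t : ℝ) (k : J) :
    ∑ a, shift z i j j' t a k = ∑ a, z a k +
      t * ((Pi.single j' (1 : ℝ) : J → ℝ) k - (Pi.single j (1 : ℝ) : J → ℝ) k) := by
  rw [← Finset.add_sum_erase _ _ (Finset.mem_univ i),
    ← Finset.add_sum_erase _ (fun a => z a k) (Finset.mem_univ i)]
  have : ∑ a ∈ Finset.univ.erase i, shift z i j j' t a k = ∑ a ∈ Finset.univ.erase i, z a k :=
    Finset.sum_congr rfl fun a ha => by simp [shift, Finset.ne_of_mem_erase ha]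
  rw [this]
  simp only [shift, Function.update_self]
  ring

/-- The quadratic congestion cost of a splitting. -/
noncomputable def congestion (N : PoolNetwork I J) (z : I → J → ℝ) : ℝ :=
  ∑ k, (∑ a, z a k) ^ 2 / N.cap k

/-- The linear term in `t` is governed by the difference of the two relative loads, so moving load
towards the less congested resource pays off for small `t`. -/
lemma congestion_shift (N : PoolNetwork I J) (z : I → J → ℝ) (i : I) {j j' : J} (hjj' : j ≠ j')
    (t : ℝ) :
    N.congestion (shift z i j j' t) = N.congestion z +
      2 * t * ((∑ a, z a j') / N.cap j' - (∑ a, z a j) / N.cap j) +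
      t ^ 2 * (1 / N.cap j' + 1 / N.cap j) := by
  have key : ∀ k, (∑ a, shift z i j j' t a k) ^ 2 / N.cap k = (∑ a, z a k) ^ 2 / N.cap k +
      ((if k = j' then 2 * t * ((∑ a, z a j') / N.cap j') + t ^ 2 * (1 / N.cap j') else 0) +
      if k = j then - (2 * t * ((∑ a, z a j) / N.cap j)) + t ^ 2 * (1 / N.cap j) else 0) := by
    intro k
    rw [sum_shift]
    by_cases h₁ : k = j
    · have h₂ : k ≠ j' := h₁ ▸ hjj'
      subst h₁
      simp [h₂]
      ring
    · by_cases h₂ : k = j'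
      · subst h₂
        simp [h₁]
        ring
      · simp [h₁, h₂]
  simp only [congestion, key, Finset.sum_add_distrib, Finset.sum_ite_eq', Finset.mem_univ, if_true]
  ring

/-- In a splitting of minimal congestion, a type only uses its least congested resources. -/
lemma congestion_le_of_isMinOn {N : PoolNetwork I J} {d : I → ℝ} {z : I → J → ℝ}
    (hz : z ∈ N.splittings d) (hmin : IsMinOn N.congestion (N.splittings d) z) {i : I} {j j' : J}
    (hj' : j' ∈ N.access i) (hzij : 0 < z i j) :
    (∑ a, z a j) / N.cap j ≤ (∑ a, z a j') / N.cap j' := by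
  by_contra! hlt
  have hjj' : j ≠ j' := by rintro rfl; exact lt_irrefl _ hlt
  have hj : j ∈ N.access i := by
    by_contra h
    exact hzij.ne' (hz.2.1 i j h)
  set δ := (∑ a, z a j) / N.cap j - (∑ a, z a j') / N.cap j' with hδ
  have hδ0 : 0 < δ := sub_pos.mpr hlt
  set B := 1 / N.cap j' + 1 / N.cap j with hB
  have hB0 : 0 < B := add_pos (one_div_pos.mpr (N.cap_pos _)) (one_div_pos.mpr (N.cap_pos _))
  -- The cost changes by `-2 * t * δ + t ^ 2 * B`, which is at most `-t * δ` once `t * B ≤ δ`.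
  set t := min (z i j) (δ / B) with ht
  have ht0 : 0 < t := lt_min hzij (div_pos hδ0 hB0)
  have htB : t * B ≤ δ := (le_div_iff₀ hB0).mp (min_le_right _ _)
  have h := hmin (shift_mem_splittings hz hj hj' ht0.le (min_le_left _ _))
  simp only [Set.mem_ofPred_eq] at h
  rw [N.congestion_shift z i hjj' t, ← hB] at h
  have e : (∑ a, z a j') / N.cap j' - (∑ a, z a j) / N.cap j = -δ := by rw [hδ]; ring
  rw [e] at h
  nlinarith [mul_le_mul_of_nonneg_left htB ht0.le, mul_pos ht0 hδ0]

/-- The transport theorem: demands can be served if no set of resources is overloaded by the types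
captive to it. -/
theorem exists_splitting_le_cap (N : PoolNetwork I J) {d : I → ℝ} (hd : ∀ i, 0 ≤ d i)
    (hcap : ∀ K : Finset J, ∑ i ∈ N.captive K, d i ≤ N.capacity K) :
    ∃ z ∈ N.splittings d, ∀ j, ∑ i, z i j ≤ N.cap j := by
  obtain ⟨z, hz, hmin⟩ := (N.isCompact_splittings d).exists_isMinOn (N.splittings_nonempty hd)
    (f := N.congestion) (by unfold congestion; fun_prop)
  refine ⟨z, hz, fun j₀ => ?_⟩
  obtain ⟨j, -, hj⟩ := Finset.exists_max_image Finset.univ (fun k => (∑ a, z a k) / N.cap k)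
    ⟨j₀, Finset.mem_univ _⟩
  set r := (∑ a, z a j) / N.cap j with hr
  suffices hr1 : r ≤ 1 by
    have := (hj j₀ (Finset.mem_univ _)).trans hr1
    rwa [div_le_one (N.cap_pos _)] at this
  -- By minimality, a type using a most congested resource has only such resources, so it is captive
  -- to `K`. Thus `r * C(K)` is at most the captive demand, hence at most `C(K)`.
  set K : Finset J := {k | (∑ a, z a k) / N.cap k = r} with hK
  have hsum : r * N.capacity K = ∑ k ∈ K, ∑ a, z a k := by
    rw [capacity, Finset.mul_sum]
    refine Finset.sum_congr rfl fun k hk => ?_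
    have : (∑ a, z a k) / N.cap k = r := by simpa [hK] using hk
    rw [← this, div_mul_cancel₀ _ (N.cap_pos k).ne']
  have hle : ∑ k ∈ K, ∑ a, z a k ≤ ∑ i ∈ N.captive K, d i := by
    rw [Finset.sum_comm, ← Finset.sum_subset (Finset.subset_univ (N.captive K))]
    · refine Finset.sum_le_sum fun i _ => ?_
      rw [← hz.2.2 i]
      exact Finset.sum_le_sum_of_subset_of_nonneg (Finset.subset_univ _) fun k _ _ => hz.1 i k
    · intro i _ hi
      refine Finset.sum_eq_zero fun k hk => ?_
      by_contra hne
      refine hi (mem_captive.mpr fun l hl => ?_)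
      have h₁ := congestion_le_of_isMinOn hz hmin hl ((hz.1 i k).lt_of_ne' hne)
      have h₂ : (∑ a, z a k) / N.cap k = r := by simpa [hK] using hk
      simpa [hK] using le_antisymm (hj l (Finset.mem_univ _)) (h₂ ▸ h₁)
  have hpos : 0 < N.capacity K :=
    Finset.sum_pos (fun k _ => N.cap_pos k) ⟨j, by simp [hK, hr]⟩
  have := hsum.le.trans (hle.trans (hcap K))
  exact le_of_mul_le_mul_right (by simpa using this) hpos

/-! ### Utilities -/

/-- A strictly concave increasing utility lies strictly below its tangents, also at the end
point. -/
lemma exists_extUtility_lt {U : ℝ → ℝ} (hc : StrictConcaveOn ℝ (Set.Ioi 0) U)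
    (hm : StrictMonoOn U (Set.Ioi 0)) (hd : DifferentiableOn ℝ U (Set.Ioi 0)) {c : ℝ}
    (hc0 : 0 < c) :
    ∃ g : ℝ, 0 ≤ g ∧ ∀ x, 0 ≤ x → x ≠ c → extUtility U x < ((U c + g * (x - c) : ℝ) : EReal) := by
  have hdc : DifferentiableAt ℝ U c := hd.differentiableAt (Ioi_mem_nhds hc0)
  set g := deriv U c with hg
  have hright : ∀ x, c < x → U x < U c + g * (x - c) := by
    intro x hx
    have h := hc.slope_lt_deriv (Set.mem_Ioi.mpr hc0) (Set.mem_Ioi.mpr (hc0.trans hx)) hx hdc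
    rw [slope_def_field, div_lt_iff₀ (sub_pos.mpr hx)] at h
    linarith
  have hleft : ∀ x, 0 < x → x < c → U x < U c + g * (x - c) := by
    intro x hx0 hx
    have h := hc.deriv_lt_slope (Set.mem_Ioi.mpr hx0) (Set.mem_Ioi.mpr hc0) hx hdc
    rw [slope_def_field, lt_div_iff₀ (sub_pos.mpr hx)] at h
    linarith
  have hg0 : 0 ≤ g := by
    have h₁ := hright (c + 1) (by linarith)
    have h₂ := hm (Set.mem_Ioi.mpr hc0) (Set.mem_Ioi.mpr (by linarith : 0 < c + 1)) (by linarith)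
    linarith
  refine ⟨g, hg0, fun x hx hxc => ?_⟩
  -- At `0` it suffices to find one `y > 0` with `U y` below the tangent value there. Left of `c /
  -- 2` chords are steeper than `s > g`, so `U y < U c - s * (c - y)`; the chosen `y` makes `s * y`
  -- a quarter of the available gap `c * (s - g)`.
  rcases hx.eq_or_lt with rfl | hx0
  · set s := (U c - U (c / 2)) / (c - c / 2) with hs
    have hsg : g < s := by
      rw [hs, lt_div_iff₀ (by linarith)]
      have := hleft (c / 2) (by linarith) (by linarith)
      linarith
    have hs0 : 0 < s := hg0.trans_lt hsg
    have hsU : s * (c / 2) = U c - U (c / 2) := by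
      rw [hs]; field_simp; ring
    set y := c * (s - g) / (4 * s) with hy
    have hy0 : 0 < y := by
      rw [hy]; have := sub_pos.mpr hsg; positivity
    have hys : y * s = c * (s - g) / 4 := by rw [hy]; field_simp
    have hyc : y < c / 2 := by
      rw [hy, div_lt_iff₀ (by positivity)]
      nlinarith [mul_nonneg hc0.le hg0, mul_pos hc0 hs0]
    have hslope := hc.slope_anti_adjacent (Set.mem_Ioi.mpr hy0) (Set.mem_Ioi.mpr hc0) hyc
      (by linarith : c / 2 < c)
    rw [← hs, lt_div_iff₀ (sub_pos.mpr hyc)] at hslope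
    have hlt : U y < U c + g * (0 - c) := by nlinarith [mul_pos hc0 (sub_pos.mpr hsg)]
    rw [extUtility, if_neg (lt_irrefl _)]
    exact (iInf_le (fun y : Set.Ioi (0 : ℝ) => (U y : EReal)) ⟨y, hy0⟩).trans_lt
      (EReal.coe_lt_coe_iff.mpr hlt)
  · rw [extUtility, if_pos hx0, EReal.coe_lt_coe_iff]
    rcases lt_or_gt_of_ne hxc with h | h
    · exact hleft x hx0 h
    · exact hright x h

end PoolNetwork

namespace PoolNetwork

variable {I J : Type*} [Fintype I] [DecidableEq I] [Fintype J] [DecidableEq J]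

lemma extUtility_of_pos (U : ℝ → ℝ) {x : ℝ} (hx : 0 < x) : extUtility U x = U x := if_pos hx

lemma extUtility_ne_bot_of_pos (U : ℝ → ℝ) {x : ℝ} (hx : 0 < x) : extUtility U x ≠ ⊥ := by
  rw [extUtility_of_pos U hx]; exact EReal.coe_ne_bot _

lemma extUtility_ne_top (U : ℝ → ℝ) (x : ℝ) : extUtility U x ≠ ⊤ := by
  unfold extUtility
  split_ifs
  · exact EReal.coe_ne_top _
  · exact ((iInf_le (fun y : Set.Ioi (0 : ℝ) => (U y : EReal)) ⟨1, Set.mem_Ioi.mpr one_pos⟩).trans_lt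
      (EReal.coe_lt_top _)).ne

lemma coe_toReal_extUtility {U : ℝ → ℝ} {x : ℝ} (h : extUtility U x ≠ ⊥) :
    (((extUtility U x).toReal : ℝ) : EReal) = extUtility U x :=
  EReal.coe_toReal (extUtility_ne_top U x) h

lemma toReal_extUtility_of_pos (U : ℝ → ℝ) {x : ℝ} (hx : 0 < x) :
    (extUtility U x).toReal = U x := by
  rw [extUtility_of_pos U hx, EReal.toReal_coe]

lemma totalUtility_eq_coe {U : ℝ → ℝ} (n : I → ℝ) {x : I → ℝ}
    (h : ∀ i, extUtility U (x i) ≠ ⊥) :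
    totalUtility U n x = ((∑ i, n i * (extUtility U (x i)).toReal : ℝ) : EReal) := by
  have hs : ∀ (s : Finset I) (f : I → ℝ), ((∑ i ∈ s, f i : ℝ) : EReal) = ∑ i ∈ s, (f i : EReal) := by
    intro s f
    induction s using Finset.induction_on with
    | empty => simp
    | insert a s ha ih => rw [Finset.sum_insert ha, Finset.sum_insert ha, EReal.coe_add, ih]
  rw [totalUtility, hs]
  exact Finset.sum_congr rfl fun i _ => by rw [EReal.coe_mul, coe_toReal_extUtility (h i)]

lemma totalUtility_eq_bot {U : ℝ → ℝ} {n x : I → ℝ} {i : I} (hn : 0 < n i)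
    (h : extUtility U (x i) = ⊥) : totalUtility U n x = ⊥ := by
  rw [totalUtility, ← Finset.add_sum_erase _ _ (Finset.mem_univ i), h,
    EReal.coe_mul_bot_of_pos hn, EReal.bot_add]

/-! ### Feasibility -/

lemma Feasible.nonneg {N : PoolNetwork I J} {n x : I → ℝ} (h : N.Feasible n x) (i : I) :
    0 ≤ x i := by
  obtain ⟨y, h0, -, hx, -⟩ := h
  rw [← hx i]
  exact Finset.sum_nonneg fun j _ => h0 i j

lemma sum_access_eq {N : PoolNetwork I J} {y : I → J → ℝ}
    (h : ∀ i j, j ∉ N.access i → y i j = 0) (i : I) :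
    ∑ j ∈ N.access i, y i j = ∑ j, y i j :=
  Finset.sum_subset (Finset.subset_univ _) fun j _ hj => h i j hj

lemma Feasible.exists_splitting {N : PoolNetwork I J} {n x : I → ℝ} (hn : ∀ i, 0 < n i)
    (h : N.Feasible n x) :
    ∃ z ∈ N.splittings (fun i => n i * x i), ∀ j, ∑ i, z i j ≤ N.cap j := by
  obtain ⟨y, h0, hs, hx, hc⟩ := h
  refine ⟨fun i j => n i * y i j, ⟨fun i j => mul_nonneg (hn i).le (h0 i j), fun i j hj => ?_,
    fun i => ?_⟩, hc⟩
  · simp [hs i j hj]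
  · rw [← Finset.mul_sum, ← sum_access_eq hs, hx]

lemma feasible_of_splitting {N : PoolNetwork I J} {n x : I → ℝ} (hn : ∀ i, 0 < n i)
    {z : I → J → ℝ} (hz : z ∈ N.splittings (fun i => n i * x i))
    (hc : ∀ j, ∑ i, z i j ≤ N.cap j) : N.Feasible n x := by
  obtain ⟨h0, hs, hx⟩ := hz
  have hs' : ∀ i j, j ∉ N.access i → z i j / n i = 0 := fun i j hj => by rw [hs i j hj, zero_div]
  refine ⟨fun i j => z i j / n i, fun i j => div_nonneg (h0 i j) (hn i).le, hs', fun i => ?_,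
    fun j => ?_⟩
  · rw [sum_access_eq hs', ← Finset.sum_div, hx, mul_div_cancel_left₀ _ (hn i).ne']
  · refine (Finset.sum_congr rfl fun i _ => ?_).trans_le (hc j)
    rw [mul_div_cancel₀ _ (hn i).ne']

lemma Feasible.sum_le_capacity {N : PoolNetwork I J} {n x : I → ℝ} (hn : ∀ i, 0 < n i)
    (h : N.Feasible n x) : ∑ i, n i * x i ≤ N.capacity Finset.univ := by
  obtain ⟨z, hz, hc⟩ := h.exists_splitting hn
  calc ∑ i, n i * x i = ∑ i, ∑ j, z i j := Finset.sum_congr rfl fun i _ => (hz.2.2 i).symm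
    _ = ∑ j, ∑ i, z i j := Finset.sum_comm
    _ ≤ N.capacity Finset.univ := Finset.sum_le_sum fun j _ => hc j

lemma exists_feasible_pos (N : PoolNetwork I J) {n : I → ℝ} (hn : ∀ i, 0 < n i) :
    ∃ x, N.Feasible n x ∧ ∀ i, 0 < x i := by
  have hT : 0 ≤ ∑ i, n i := Finset.sum_nonneg fun i _ => (hn i).le
  have hpos : ∀ j, 0 < N.cap j / (∑ i, n i + 1) := fun j => div_pos (N.cap_pos j) (by linarith)
  refine ⟨fun i => ∑ j ∈ N.access i, N.cap j / (∑ i, n i + 1),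
    ⟨fun i j => if j ∈ N.access i then N.cap j / (∑ i, n i + 1) else 0, fun i j => ?_,
      fun i j hj => if_neg hj, fun i => Finset.sum_congr rfl fun j hj => if_pos hj, fun j => ?_⟩,
    fun i => Finset.sum_pos (fun j _ => hpos j) (N.access_nonempty i)⟩
  · beta_reduce
    split_ifs
    exacts [(hpos j).le, le_rfl]
  · calc ∑ i, n i * (if j ∈ N.access i then N.cap j / (∑ i, n i + 1) else 0)
        ≤ ∑ i, n i * (N.cap j / (∑ i, n i + 1)) := by
          refine Finset.sum_le_sum fun i _ => mul_le_mul_of_nonneg_left ?_ (hn i).le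
          split_ifs
          exacts [le_rfl, (hpos j).le]
      _ = (∑ i, n i) * (N.cap j / (∑ i, n i + 1)) := by rw [Finset.sum_mul]
      _ ≤ (∑ i, n i + 1) * (N.cap j / (∑ i, n i + 1)) :=
          mul_le_mul_of_nonneg_right (by linarith) (hpos j).le
      _ = N.cap j := mul_div_cancel₀ _ (by linarith)

/-! ### Optimal allocations -/

lemma IsRateAllocation.extUtility_ne_bot {N : PoolNetwork I J} {U : ℝ → ℝ} {n x : I → ℝ}
    (hn : ∀ i, 0 < n i) (hx : N.IsRateAllocation U n x) (i : I) : extUtility U (x i) ≠ ⊥ := by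
  intro h
  obtain ⟨w, hw, hw0⟩ := N.exists_feasible_pos hn
  have hle := hx.2.2 w hw
  rw [totalUtility_eq_bot (hn i) h,
    totalUtility_eq_coe n fun i => extUtility_ne_bot_of_pos U (hw0 i), le_bot_iff] at hle
  exact EReal.coe_ne_bot _ hle

/-- The condition `h` keeps all utilities of the competitor finite, so that optimality can be used
in `ℝ`. -/
lemma IsRateAllocation.sum_le {N : PoolNetwork I J} {U : ℝ → ℝ} {n x x' : I → ℝ}
    (hn : ∀ i, 0 < n i) (hx : N.IsRateAllocation U n x) (hx' : N.Feasible n x')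
    (h : ∀ i, x' i = x i ∨ 0 < x' i) :
    ∑ i, n i * (extUtility U (x' i)).toReal ≤ ∑ i, n i * (extUtility U (x i)).toReal := by
  have hle := hx.2.2 x' hx'
  rwa [totalUtility_eq_coe n (hx.extUtility_ne_bot hn), totalUtility_eq_coe n,
    EReal.coe_le_coe_iff] at hle
  intro i
  rcases h i with h | h
  · rw [h]; exact hx.extUtility_ne_bot hn i
  · exact extUtility_ne_bot_of_pos U h

lemma sum_shift_row (z : I → J → ℝ) (i : I) (j j' : J) (t : ℝ) (a : I) :
    ∑ k, shift z i j j' t a k = ∑ k, z a k := by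
  rcases eq_or_ne a i with rfl | ha
  · simp [shift, Finset.sum_add_distrib, ← Finset.mul_sum, Finset.sum_sub_distrib]
  · simp [shift, ha]

/-- In an optimal allocation, no type that can use a resource has a lower rate than a type that
does use it. -/
lemma IsRateAllocation.le_of_uses {N : PoolNetwork I J} {U : ℝ → ℝ}
    (hU : StrictConcaveOn ℝ (Set.Ioi 0) U)
    (hm : StrictMonoOn U (Set.Ioi 0)) (hd : DifferentiableOn ℝ U (Set.Ioi 0)) {n x : I → ℝ}
    (hn : ∀ i, 0 < n i) (hx : N.IsRateAllocation U n x) {z : I → J → ℝ}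
    (hz : z ∈ N.splittings (fun i => n i * x i)) (hc : ∀ j, ∑ i, z i j ≤ N.cap j)
    {i i' : I} {j : J} (hzij : 0 < z i j) (hj' : j ∈ N.access i') : x i ≤ x i' := by
  by_contra! hlt
  have hii' : i ≠ i' := by rintro rfl; exact lt_irrefl _ hlt
  have hj : j ∈ N.access i := by
    by_contra h
    exact hzij.ne' (hz.2.1 i j h)
  set B := 1 / n i + 1 / n i' with hB
  have hB0 : 0 < B := add_pos (one_div_pos.mpr (hn _)) (one_div_pos.mpr (hn _))
  -- The factor `2` keeps the rate of `i` strictly above that of `i'` after the transfer.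
  set t := min (z i j) ((x i - x i') / (2 * B)) with ht
  have ht0 : 0 < t := lt_min hzij (div_pos (sub_pos.mpr hlt) (by positivity))
  have htz : t ≤ z i j := min_le_left _ _
  have htB : t * (2 * B) ≤ x i - x i' := (le_div_iff₀ (by positivity)).mp (min_le_right _ _)
  set c := x i - t / n i with hc₁
  set c' := x i' + t / n i' with hc₂
  have hi'0 : 0 ≤ x i' := hx.1.nonneg i'
  have hti : 0 < t / n i := div_pos ht0 (hn i)
  have hti' : 0 < t / n i' := div_pos ht0 (hn i')
  have hcc : c' < c := by
    have : t * B = t / n i + t / n i' := by rw [hB]; ring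
    linarith
  have hc'0 : 0 < c' := by linarith
  have hc0 : 0 < c := hc'0.trans hcc
  -- Tangents are taken at the new rates, which are positive, whereas `x i'` may be `0`. Type `i`
  -- loses less than `t * g` and type `i'` gains more than `t * g'`.
  obtain ⟨g, -, hg⟩ := exists_extUtility_lt hU hm hd hc0
  obtain ⟨g', -, hg'⟩ := exists_extUtility_lt hU hm hd hc'0
  have hgg : g < g' := by
    have h₁ := hg c' hc'0.le hcc.ne
    have h₂ := hg' c hc0.le hcc.ne'
    rw [extUtility_of_pos U hc'0, EReal.coe_lt_coe_iff] at h₁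
    rw [extUtility_of_pos U hc0, EReal.coe_lt_coe_iff] at h₂
    nlinarith
  set x' : I → ℝ := Function.update (Function.update x i c) i' c' with hx'
  have hx'i : x' i = c := by simp [hx', hii']
  have hx'i' : x' i' = c' := by simp [hx']
  have hx'a : ∀ a, a ≠ i → a ≠ i' → x' a = x a := fun a h₁ h₂ => by simp [hx', h₁, h₂]
  have hfeas : N.Feasible n x' := by
    -- `shift` acts on the transposed matrix: load on the fixed resource `j` passes from type `i` to
    -- `i'`.
    refine feasible_of_splitting hn (z := fun a k => shift (fun k a => z a k) j i i' t k a)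
      ⟨fun a k => ?_, fun a k hk => ?_, fun a => ?_⟩ fun k => ?_
    · exact shift_nonneg (fun k a => hz.1 a k) ht0.le htz k a
    · rcases eq_or_ne k j with rfl | hkj
      · have h₁ : a ≠ i := fun h => hk (h ▸ hj)
        have h₂ : a ≠ i' := fun h => hk (h ▸ hj')
        simp [shift, h₁, h₂, hz.2.1 a k hk]
      · simpa [shift, hkj] using hz.2.1 a k hk
    · rw [sum_shift, hz.2.2]
      beta_reduce
      have hni := (hn i).ne'
      have hni' := (hn i').ne'
      by_cases h₁ : a = i
      · subst h₁
        rw [hx'i]; simp [hii', hc₁]; field_simp; ring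
      · by_cases h₂ : a = i'
        · subst h₂
          rw [hx'i']; simp [h₁, hc₂]; field_simp
        · simp [hx'a a h₁ h₂, h₁, h₂]
    · rw [sum_shift_row]
      exact hc k
  have hle := hx.sum_le hn hfeas fun a => by
    by_cases h₁ : a = i
    · subst h₁; right; rwa [hx'i]
    · by_cases h₂ : a = i'
      · subst h₂; right; rwa [hx'i']
      · exact Or.inl (hx'a a h₁ h₂)
  have hW : ∀ a, ((((extUtility U (x a)).toReal : ℝ)) : EReal) = extUtility U (x a) :=
    fun a => coe_toReal_extUtility (hx.extUtility_ne_bot hn a)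
  have hi : n i * (extUtility U (x i)).toReal < n i * (extUtility U (x' i)).toReal + t * g := by
    have h := hg (x i) (hx.1.nonneg i) (by linarith : c < x i).ne'
    rw [← hW, EReal.coe_lt_coe_iff] at h
    rw [hx'i, toReal_extUtility_of_pos U hc0]
    have h₂ := mul_lt_mul_of_pos_left h (hn i)
    have h₃ : n i * (t / n i) = t := mul_div_cancel₀ _ (hn i).ne'
    have h₄ : x i - c = t / n i := by rw [hc₁]; ring
    rw [h₄] at h₂
    linear_combination h₂ + g * h₃
  have hi' : n i' * (extUtility U (x i')).toReal
      < n i' * (extUtility U (x' i')).toReal - t * g' := by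
    have h := hg' (x i') hi'0 (by linarith : x i' < c').ne
    rw [← hW, EReal.coe_lt_coe_iff] at h
    rw [hx'i', toReal_extUtility_of_pos U hc'0]
    have h₂ := mul_lt_mul_of_pos_left h (hn i')
    have h₃ : n i' * (t / n i') = t := mul_div_cancel₀ _ (hn i').ne'
    have h₄ : x i' - c' = -(t / n i') := by rw [hc₂]; ring
    rw [h₄] at h₂
    linear_combination h₂ - g' * h₃
  have hmem : i' ∈ Finset.univ.erase i := Finset.mem_erase.mpr ⟨hii'.symm, Finset.mem_univ _⟩
  rw [← Finset.add_sum_erase _ _ (Finset.mem_univ i), ← Finset.add_sum_erase _ _ hmem,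
    ← Finset.add_sum_erase _ (fun a => n a * (extUtility U (x a)).toReal) (Finset.mem_univ i),
    ← Finset.add_sum_erase _ (fun a => n a * (extUtility U (x a)).toReal) hmem] at hle
  have hrest : ∑ a ∈ (Finset.univ.erase i).erase i', n a * (extUtility U (x' a)).toReal =
      ∑ a ∈ (Finset.univ.erase i).erase i', n a * (extUtility U (x a)).toReal :=
    Finset.sum_congr rfl fun a ha => by
      rw [hx'a a (Finset.ne_of_mem_erase (Finset.mem_of_mem_erase ha)) (Finset.ne_of_mem_erase ha)]
  rw [hrest] at hle
  nlinarith [mul_pos ht0 (sub_pos.mpr hgg)]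

/-- An optimal allocation saturates every resource that some type can use. -/
lemma IsRateAllocation.sum_eq_cap {N : PoolNetwork I J} {U : ℝ → ℝ}
    (hU : StrictConcaveOn ℝ (Set.Ioi 0) U)
    (hm : StrictMonoOn U (Set.Ioi 0)) (hd : DifferentiableOn ℝ U (Set.Ioi 0)) {n x : I → ℝ}
    (hn : ∀ i, 0 < n i) (hx : N.IsRateAllocation U n x) {z : I → J → ℝ}
    (hz : z ∈ N.splittings (fun i => n i * x i)) (hc : ∀ j, ∑ i, z i j ≤ N.cap j)
    {i : I} {j : J} (hj : j ∈ N.access i) : ∑ a, z a j = N.cap j := by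
  by_contra hne
  set t := N.cap j - ∑ a, z a j with ht
  have ht0 : 0 < t := sub_pos.mpr ((hc j).lt_of_ne hne)
  -- All the spare capacity of `j` goes to type `i`.
  set c := x i + t / n i with hc₁
  have hti : 0 < t / n i := div_pos ht0 (hn i)
  have hc0 : 0 < c := by linarith [hx.1.nonneg i]
  set x' : I → ℝ := Function.update x i c with hx'
  have hx'i : x' i = c := by simp [hx']
  have hfeas : N.Feasible n x' := by
    refine feasible_of_splitting hn
      (z := fun a k => z a k + if a = i then (if k = j then t else 0) else 0)
      ⟨fun a k => ?_, fun a k hk => ?_, fun a => ?_⟩ fun k => ?_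
    · have := hz.1 a k
      beta_reduce
      split_ifs <;> linarith
    · have h : ¬ (a = i ∧ k = j) := by rintro ⟨rfl, rfl⟩; exact hk hj
      have := hz.2.1 a k hk
      beta_reduce
      split_ifs <;> simp_all
    · rw [Finset.sum_add_distrib, hz.2.2]
      by_cases h : a = i
      · subst h
        simp [hx'i, hc₁, mul_add, mul_div_cancel₀ _ (hn a).ne']
      · simp [h, hx']
    · rw [Finset.sum_add_distrib]
      by_cases h : k = j
      · subst h; simp [ht]
      · simpa [h] using hc k
  have hle := hx.sum_le hn hfeas fun a => by
    by_cases h : a = i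
    · subst h; right; rwa [hx'i]
    · left; simp [hx', h]
  rw [← Finset.add_sum_erase _ _ (Finset.mem_univ i),
    ← Finset.add_sum_erase _ (fun a => n a * (extUtility U (x a)).toReal) (Finset.mem_univ i),
    Finset.sum_congr rfl fun a ha => by
      rw [show x' a = x a by simp [hx', Finset.ne_of_mem_erase ha]],
    add_le_add_iff_right, mul_le_mul_iff_right₀ (hn i), hx'i, toReal_extUtility_of_pos U hc0] at hle
  obtain ⟨g, hg0, hg⟩ := exists_extUtility_lt hU hm hd hc0
  have h := hg (x i) (hx.1.nonneg i) (by linarith : x i < c).ne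
  rw [← coe_toReal_extUtility (hx.extUtility_ne_bot hn i), EReal.coe_lt_coe_iff] at h
  nlinarith [mul_nonneg hg0 (by linarith : 0 ≤ c - x i)]

/-! ### Optimality of the uniform allocation, and pooling as an open condition -/

/-- The uniform allocation that exhausts the total capacity is strictly better than any other. -/
lemma totalUtility_lt_const {N : PoolNetwork I J} {U : ℝ → ℝ}
    (hU : StrictConcaveOn ℝ (Set.Ioi 0) U)
    (hm : StrictMonoOn U (Set.Ioi 0)) (hd : DifferentiableOn ℝ U (Set.Ioi 0)) {n x : I → ℝ}
    (hn : ∀ i, 0 < n i) {c : ℝ} (hc : 0 < c) (hcap : N.capacity Finset.univ = (∑ i, n i) * c)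
    (hx : N.Feasible n x) (hne : x ≠ fun _ => c) :
    totalUtility U n x < totalUtility U n fun _ => c := by
  rw [totalUtility_eq_coe n (x := fun _ => c) fun _ => extUtility_ne_bot_of_pos U hc]
  by_cases hbot : ∃ i, extUtility U (x i) = ⊥
  · obtain ⟨i, hi⟩ := hbot
    rw [totalUtility_eq_bot (hn i) hi]
    exact EReal.bot_lt_coe _
  push Not at hbot
  rw [totalUtility_eq_coe n hbot, EReal.coe_lt_coe_iff, toReal_extUtility_of_pos U hc]
  obtain ⟨g, hg0, hg⟩ := exists_extUtility_lt hU hm hd hc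
  have hlt : ∀ i, x i ≠ c → (extUtility U (x i)).toReal < U c + g * (x i - c) := by
    intro i hi
    have h := hg (x i) (hx.nonneg i) hi
    rwa [← coe_toReal_extUtility (hbot i), EReal.coe_lt_coe_iff] at h
  have hle : ∀ i, (extUtility U (x i)).toReal ≤ U c + g * (x i - c) := by
    intro i
    by_cases hi : x i = c
    · rw [hi, toReal_extUtility_of_pos U hc]; simp
    · exact (hlt i hi).le
  obtain ⟨i, hi⟩ := Function.ne_iff.mp hne
  calc ∑ i, n i * (extUtility U (x i)).toReal < ∑ i, n i * (U c + g * (x i - c)) :=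
        Finset.sum_lt_sum (fun i _ => mul_le_mul_of_nonneg_left (hle i) (hn i).le)
          ⟨i, Finset.mem_univ _, mul_lt_mul_of_pos_left (hlt i hi) (hn i)⟩
    _ = ∑ i, n i * U c + g * (∑ i, n i * x i - (∑ i, n i) * c) := by
        rw [Finset.sum_mul, ← Finset.sum_sub_distrib, Finset.mul_sum, ← Finset.sum_add_distrib]
        exact Finset.sum_congr rfl fun i _ => by ring
    _ ≤ ∑ i, n i * U c := by
        have := hx.sum_le_capacity hn
        nlinarith [mul_nonneg hg0 (by linarith : 0 ≤ (∑ i, n i) * c - ∑ i, n i * x i)]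

lemma isRateAllocation_iff_const {N : PoolNetwork I J} {U : ℝ → ℝ}
    (hU : StrictConcaveOn ℝ (Set.Ioi 0) U)
    (hm : StrictMonoOn U (Set.Ioi 0)) (hd : DifferentiableOn ℝ U (Set.Ioi 0)) {n : I → ℝ}
    (hn : ∀ i, 0 < n i) {c : ℝ} (hc : 0 < c) (hcap : N.capacity Finset.univ = (∑ i, n i) * c)
    (hload : ∀ K : Finset J, (∑ i ∈ N.captive K, n i) * c ≤ N.capacity K) (x : I → ℝ) :
    N.IsRateAllocation U n x ↔ x = fun _ => c := by
  have hfeas : N.Feasible n fun _ => c := by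
    obtain ⟨z, hz, hzc⟩ := N.exists_splitting_le_cap (d := fun i => n i * c)
      (fun i => mul_nonneg (hn i).le hc.le) fun K => by simpa [Finset.sum_mul] using hload K
    exact feasible_of_splitting hn hz hzc
  constructor
  · intro hx
    by_contra hne
    exact (hx.2.2 _ hfeas).not_gt (totalUtility_lt_const hU hm hd hn hc hcap hx.1 hne)
  · rintro rfl
    refine ⟨hfeas, fun i hi => absurd hi (hn i).ne', fun x' hx' => ?_⟩
    by_cases hne : x' = fun _ => c
    · rw [hne]
    · exact (totalUtility_lt_const hU hm hd hn hc hcap hx' hne).le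

/-- Only finitely many strict inequalities, continuous in `n`, are involved, so they persist nearby.
The empty and the full set satisfy the weak inequality automatically. -/
lemma completeResourcePooling_of_lt [Nonempty I] {N : PoolNetwork I J} {U : ℝ → ℝ}
    (hU : StrictConcaveOn ℝ (Set.Ioi 0) U)
    (hm : StrictMonoOn U (Set.Ioi 0)) (hd : DifferentiableOn ℝ U (Set.Ioi 0)) {n : I → ℝ}
    (hn : ∀ i, 0 < n i)
    (hload : ∀ K : Finset J, K.Nonempty → K ≠ Finset.univ →
      (∑ i ∈ N.captive K, n i) * N.capacity Finset.univ < N.capacity K * ∑ i, n i) :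
    N.CompleteResourcePooling U n := by
  have hpos : ∀ᶠ n' in 𝓝 n, ∀ i, 0 < n' i := eventually_all.mpr fun i =>
    (continuous_apply i).continuousAt.eventually (lt_mem_nhds (hn i))
  have hev : ∀ᶠ n' in 𝓝 n, ∀ K : Finset J, K.Nonempty → K ≠ Finset.univ →
      (∑ i ∈ N.captive K, n' i) * N.capacity Finset.univ < N.capacity K * ∑ i, n' i := by
    refine eventually_all.mpr fun K => ?_
    by_cases hK : K.Nonempty ∧ K ≠ Finset.univ
    · refine (ContinuousAt.eventually_lt (f := fun n' : I → ℝ =>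
        (∑ i ∈ N.captive K, n' i) * N.capacity Finset.univ)
        (g := fun n' : I → ℝ => N.capacity K * ∑ i, n' i)
        (by fun_prop) (by fun_prop) (hload K hK.1 hK.2)).mono fun n' h _ _ => h
    · exact Eventually.of_forall fun n' h₁ h₂ => absurd ⟨h₁, h₂⟩ hK
  refine nhdsWithin_le_nhds ?_
  filter_upwards [hpos, hev] with n' hn' hK
  have hT : 0 < ∑ i, n' i := Finset.sum_pos (fun i _ => hn' i) Finset.univ_nonempty
  have hC : 0 < N.capacity Finset.univ := Finset.sum_pos (fun j _ => N.cap_pos j)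
    ((N.access_nonempty (Classical.arbitrary I)).mono (Finset.subset_univ _))
  refine isRateAllocation_iff_const hU hm hd hn' (div_pos hC hT)
    (mul_div_cancel₀ _ hT.ne').symm fun K => ?_
  rw [← mul_div_assoc, div_le_iff₀ hT]
  rcases K.eq_empty_or_nonempty with rfl | hne
  · have : N.captive ∅ = ∅ := by
      ext i; simpa [mem_captive] using (N.access_nonempty i).ne_empty
    simp [this, capacity]
  · by_cases hu : K = Finset.univ
    · rw [hu, captive_univ, mul_comm]
    · exact (hK K hne hu).le

/-! ### Rigidity of optimal allocations -/

/-- If every set of resources has more slack than the whole network, optimal allocations under which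
the served load dominates `ρ` are uniform. -/
lemma IsRateAllocation.eq_of_slack_lt {N : PoolNetwork I J} {U : ℝ → ℝ}
    (hU : StrictConcaveOn ℝ (Set.Ioi 0) U)
    (hm : StrictMonoOn U (Set.Ioi 0)) (hd : DifferentiableOn ℝ U (Set.Ioi 0)) {n x ρ : I → ℝ}
    (hn : ∀ i, 0 < n i) (hx : N.IsRateAllocation U n x)
    (hslack : ∀ K : Finset J, K.Nonempty → K ≠ Finset.univ →
      N.slack ρ Finset.univ < N.slack ρ K)
    (hload : ∀ i, ρ i ≤ n i * x i) (i i' : I) : x i = x i' := by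
  obtain ⟨z, hz, hc⟩ := hx.1.exists_splitting hn
  obtain ⟨i₀, -, hi₀⟩ := Finset.exists_max_image Finset.univ x ⟨i, Finset.mem_univ _⟩
  suffices h : ∀ a, x a = x i₀ by rw [h i, h i']
  by_contra! hne
  obtain ⟨i₁, hi₁⟩ := hne
  set A : Finset I := {a | x a = x i₀} with hA
  have memA : ∀ {a}, a ∈ A ↔ x a = x i₀ := by simp [hA]
  set L : Finset J := {j | ∃ a, a ∉ A ∧ j ∈ N.access a} with hL
  have memL : ∀ {j}, j ∈ L ↔ ∃ a, a ∉ A ∧ j ∈ N.access a := by simp [hL]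
  have hpos : 0 < x i₀ :=
    (hx.1.nonneg i₁).trans_lt ((hi₀ i₁ (Finset.mem_univ _)).lt_of_ne hi₁)
  have huse : ∀ a ∈ A, ∀ j ∈ L, z a j = 0 := by
    intro a ha j hj
    by_contra h
    obtain ⟨b, hb, hjb⟩ := memL.mp hj
    have h₁ := hx.le_of_uses hU hm hd hn hz hc ((hz.1 a j).lt_of_ne' h) hjb
    exact hb (memA.mpr (le_antisymm (hi₀ b (Finset.mem_univ _)) (memA.mp ha ▸ h₁)))
  -- A type in `A` captive to `L` would be served nowhere, although its rate is the positive
  -- maximum.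
  have hcaptive : N.captive L = Aᶜ := by
    ext a
    rw [mem_captive, Finset.mem_compl]
    refine ⟨fun h ha => ?_, fun ha j hj => memL.mpr ⟨a, ha, hj⟩⟩
    have hzero : ∑ j, z a j = 0 := Finset.sum_eq_zero fun j _ => by
      by_cases hj : j ∈ N.access a
      · exact huse a ha j (h hj)
      · exact hz.2.1 a j hj
    rw [hz.2.2 a] at hzero
    beta_reduce at hzero
    rw [memA.mp ha] at hzero
    exact (mul_pos (hn a) hpos).ne' hzero
  have hLne : L.Nonempty := by
    obtain ⟨j, hj⟩ := N.access_nonempty i₁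
    exact ⟨j, memL.mpr ⟨i₁, fun h => hi₁ (memA.mp h), hj⟩⟩
  have hLu : L ≠ Finset.univ := by
    intro h
    rw [h, captive_univ] at hcaptive
    have : i₀ ∈ Aᶜ := hcaptive ▸ Finset.mem_univ i₀
    exact Finset.mem_compl.mp this (memA.mpr rfl)
  -- After cancellation this says that the load `ρ` of `A` exceeds the capacity of `Lᶜ`,
  -- contradicting `hserved`.
  have h := hslack L hLne hLu
  rw [slack, slack, captive_univ, hcaptive, ← N.capacity_add_compl L,
    ← Finset.sum_add_sum_compl A ρ] at h
  have hserved : ∑ a ∈ A, ρ a ≤ N.capacity Lᶜ :=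
    calc ∑ a ∈ A, ρ a ≤ ∑ a ∈ A, ∑ j ∈ Lᶜ, z a j := by
          refine Finset.sum_le_sum fun a ha => ?_
          rw [Finset.sum_subset (Finset.subset_univ Lᶜ) fun j _ hj =>
            huse a ha j (by simpa using hj), hz.2.2 a]
          exact hload a
      _ ≤ ∑ a, ∑ j ∈ Lᶜ, z a j := Finset.sum_le_sum_of_subset_of_nonneg (Finset.subset_univ _)
          fun a _ _ => Finset.sum_nonneg fun j _ => hz.1 a j
      _ = ∑ j ∈ Lᶜ, ∑ a, z a j := Finset.sum_comm
      _ ≤ N.capacity Lᶜ := Finset.sum_le_sum fun j _ => hc j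
  linarith

/-- Removing a resource that no type can use lowers the capacity but not the captive load, giving a
proper set with less slack than the network. -/
lemma exists_mem_access [Nonempty I] {N : PoolNetwork I J} {ρ : I → ℝ}
    (hslack : ∀ K : Finset J, K.Nonempty → K ≠ Finset.univ →
      N.slack ρ Finset.univ < N.slack ρ K) (j : J) : ∃ i, j ∈ N.access i := by
  by_contra! hj
  have hcaptive : N.captive ({j}ᶜ : Finset J) = Finset.univ := by
    ext i; simpa [mem_captive, Finset.subset_compl_singleton] using hj i
  obtain ⟨i⟩ := ‹Nonempty I›
  obtain ⟨k, hk⟩ := N.access_nonempty i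
  have h := hslack {j}ᶜ ⟨k, by
    rw [Finset.mem_compl, Finset.mem_singleton]
    rintro rfl
    exact hj i hk⟩ (by simp)
  have hadd := N.capacity_add_compl {j}
  have hjpos : 0 < N.capacity {j} := by simpa [capacity] using N.cap_pos j
  rw [slack, slack, captive_univ, hcaptive] at h
  linarith

lemma IsRateAllocation.sum_eq_capacity [Nonempty I] {N : PoolNetwork I J} {U : ℝ → ℝ}
    (hU : StrictConcaveOn ℝ (Set.Ioi 0) U)
    (hm : StrictMonoOn U (Set.Ioi 0)) (hd : DifferentiableOn ℝ U (Set.Ioi 0)) {n x : I → ℝ}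
    (hn : ∀ i, 0 < n i) (hx : N.IsRateAllocation U n x)
    (hacc : ∀ j, ∃ i, j ∈ N.access i) : ∑ i, n i * x i = N.capacity Finset.univ := by
  obtain ⟨z, hz, hc⟩ := hx.1.exists_splitting hn
  calc ∑ i, n i * x i = ∑ i, ∑ j, z i j := Finset.sum_congr rfl fun i _ => (hz.2.2 i).symm
    _ = ∑ j, ∑ i, z i j := Finset.sum_comm
    _ = N.capacity Finset.univ := Finset.sum_congr rfl fun j _ => by
        obtain ⟨i, hi⟩ := hacc j
        exact hx.sum_eq_cap hU hm hd hn hz hc hi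

/-! ### The equilibrium state and its uniqueness -/

/-- Elastic flow numbers at which the uniform allocation balances the loads `ρ`, given the numbers
`m` of streaming flows. -/
noncomputable def balancedFlows (N : PoolNetwork I J) (ρ m : I → ℝ) : I → ℝ :=
  fun i => ρ i * (∑ a, m a) / N.slack ρ Finset.univ

lemma sum_balancedFlows_add (N : PoolNetwork I J) {ρ : I → ℝ} (m : I → ℝ) (K : Finset I) :
    ∑ i ∈ K, (N.balancedFlows ρ m + m) i =
      (∑ i ∈ K, ρ i) * (∑ i, m i) / N.slack ρ Finset.univ + ∑ i ∈ K, m i := by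
  simp only [balancedFlows, Pi.add_apply, Finset.sum_add_distrib, Finset.sum_div, Finset.sum_mul]

lemma sum_balancedFlows_add_univ (N : PoolNetwork I J) {ρ : I → ℝ} (m : I → ℝ)
    (hδ : N.slack ρ Finset.univ ≠ 0) :
    ∑ i, (N.balancedFlows ρ m + m) i =
      N.capacity Finset.univ * (∑ i, m i) / N.slack ρ Finset.univ := by
  rw [sum_balancedFlows_add N m]
  have : N.capacity Finset.univ = N.slack ρ Finset.univ + ∑ i, ρ i := by
    rw [slack, captive_univ]; ring
  rw [this]
  field_simp
  ring

lemma completeResourcePooling_balancedFlows [Nonempty I] {N : PoolNetwork I J} {U : ℝ → ℝ}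
    (hU : StrictConcaveOn ℝ (Set.Ioi 0) U)
    (hm : StrictMonoOn U (Set.Ioi 0)) (hd : DifferentiableOn ℝ U (Set.Ioi 0)) {ρ m : I → ℝ}
    (hρ : ∀ i, 0 ≤ ρ i) (hm0 : ∀ i, 0 < m i) (hδ : 0 < N.slack ρ Finset.univ)
    (hslack : ∀ K : Finset J, K.Nonempty → K ≠ Finset.univ →
      N.slack ρ Finset.univ < N.slack ρ K) :
    N.CompleteResourcePooling U (N.balancedFlows ρ m + m) := by
  have hM : 0 < ∑ i, m i := Finset.sum_pos (fun i _ => hm0 i) Finset.univ_nonempty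
  have hC : 0 < N.capacity Finset.univ := Finset.sum_pos (fun j _ => N.cap_pos j)
    ((N.access_nonempty (Classical.arbitrary I)).mono (Finset.subset_univ _))
  refine completeResourcePooling_of_lt hU hm hd (fun i => add_pos_of_nonneg_of_pos
    (div_nonneg (mul_nonneg (hρ i) hM.le) hδ.le) (hm0 i)) fun K hK hKu => ?_
  rw [sum_balancedFlows_add_univ N m hδ.ne', sum_balancedFlows_add N m]
  -- Bounding the captive streaming flows by all of them costs at most `δ` in load, exactly what the
  -- slack gap allows.
  have hmK : ∑ i ∈ N.captive K, m i ≤ ∑ i, m i :=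
    Finset.sum_le_sum_of_subset_of_nonneg (Finset.subset_univ _) fun i _ _ => (hm0 i).le
  have hs := hslack K hK hKu
  have hs' : N.capacity K = N.slack ρ K + ∑ i ∈ N.captive K, ρ i := by rw [slack]; ring
  calc ((∑ i ∈ N.captive K, ρ i) * (∑ i, m i) / N.slack ρ Finset.univ + ∑ i ∈ N.captive K, m i)
        * N.capacity Finset.univ
      ≤ ((∑ i ∈ N.captive K, ρ i) * (∑ i, m i) / N.slack ρ Finset.univ + ∑ i, m i)
        * N.capacity Finset.univ := by gcongr
    _ = (∑ i ∈ N.captive K, ρ i + N.slack ρ Finset.univ) *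
        (N.capacity Finset.univ * (∑ i, m i) / N.slack ρ Finset.univ) := by field_simp
    _ < N.capacity K * (N.capacity Finset.univ * (∑ i, m i) / N.slack ρ Finset.univ) := by
        refine mul_lt_mul_of_pos_right (by linarith) (by positivity)

lemma eq_balancedFlows [Nonempty I] {N : PoolNetwork I J} {U : ℝ → ℝ}
    (hU : StrictConcaveOn ℝ (Set.Ioi 0) U)
    (hm : StrictMonoOn U (Set.Ioi 0)) (hd : DifferentiableOn ℝ U (Set.Ioi 0)) {ρ n m x : I → ℝ}
    (hn0 : ∀ i, 0 ≤ n i) (hm0 : ∀ i, 0 < m i) (hδ : 0 < N.slack ρ Finset.univ)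
    (hslack : ∀ K : Finset J, K.Nonempty → K ≠ Finset.univ →
      N.slack ρ Finset.univ < N.slack ρ K)
    (hx : N.IsRateAllocation U (n + m) x) (hbal : ∀ i, n i * x i = ρ i) :
    n = N.balancedFlows ρ m := by
  have hpos : ∀ i, 0 < (n + m) i := fun i => add_pos_of_nonneg_of_pos (hn0 i) (hm0 i)
  have hM : 0 < ∑ i, m i := Finset.sum_pos (fun i _ => hm0 i) Finset.univ_nonempty
  set a := x (Classical.arbitrary I) with ha
  have hxa : ∀ i, x i = a := fun i => hx.eq_of_slack_lt hU hm hd hpos hslack (fun i => by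
    rw [Pi.add_apply, add_mul, hbal]
    linarith [mul_nonneg (hm0 i).le (hx.1.nonneg i)]) i _
  have htot := hx.sum_eq_capacity hU hm hd hpos (exists_mem_access hslack)
  have hMa : (∑ i, m i) * a = N.slack ρ Finset.univ := by
    rw [slack, captive_univ, ← htot, Finset.sum_mul, ← Finset.sum_sub_distrib]
    refine Finset.sum_congr rfl fun i _ => ?_
    rw [← hbal i, hxa i, Pi.add_apply]
    ring
  funext i
  rw [balancedFlows, eq_div_iff hδ.ne', ← hMa, ← hbal i, hxa i]
  ring

end PoolNetwork

open PoolNetwork in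
theorem mainTheorem7 {I J : Type*} [Fintype I] [DecidableEq I] [Fintype J] [DecidableEq J]
    (N : PoolNetwork I J) (U : ℝ → ℝ)
    (hU_concave : StrictConcaveOn ℝ (Set.Ioi 0) U)
    (hU_mono : StrictMonoOn U (Set.Ioi 0))
    (hU_diff : DifferentiableOn ℝ U (Set.Ioi 0))
    (lam μ κ η ρ : I → ℝ)
    (hlam : ∀ i, 0 ≤ lam i) (hμ : ∀ i, 0 < μ i) (hκ : ∀ i, 0 < κ i) (hη : ∀ i, 0 < η i)
    (hρ : ∀ i, ρ i = lam i / μ i)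
    (hstable : N.Stable ρ)
    (hpool : ∀ J' : Finset J, J'.Nonempty → N.StronglyConnected J'ᶜ →
      N.capacity J' < ∑ i ∈ (N.captive J'ᶜ)ᶜ, ρ i) :
    ∃ n m : I → ℝ,
      N.IsEquilibrium U lam μ κ η n m ∧
      (∀ n' m' : I → ℝ, N.IsEquilibrium U lam μ κ η n' m' → n' = n ∧ m' = m) ∧
      N.CompleteResourcePooling U (n + m) := by
  -- Without types the total number of flows is `0` and the formulas degenerate, but all vectors
  -- coincide.
  rcases isEmpty_or_nonempty I with hI | hI
  · have hall : ∀ n x : I → ℝ, N.IsRateAllocation U n x := fun n x =>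
      ⟨⟨isEmptyElim, isEmptyElim, isEmptyElim, isEmptyElim,
        fun j => by simpa using (N.cap_pos j).le⟩, isEmptyElim, fun x' _ => by simp [totalUtility]⟩
    refine ⟨isEmptyElim, isEmptyElim, ⟨isEmptyElim, isEmptyElim, isEmptyElim, hall _ _,
      isEmptyElim, isEmptyElim⟩, fun n' m' _ => ⟨Subsingleton.elim _ _, Subsingleton.elim _ _⟩,
      Eventually.of_forall fun n' x => ⟨fun _ => Subsingleton.elim _ _, fun _ => hall _ _⟩⟩
  have hρ0 : ∀ i, 0 ≤ ρ i := fun i => hρ i ▸ div_nonneg (hlam i) (hμ i).le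
  have hJ : (Finset.univ : Finset J).Nonempty :=
    (N.access_nonempty (Classical.arbitrary I)).mono (Finset.subset_univ _)
  have hδ := hstable.slack_pos Finset.univ hJ
  have hslack := hstable.slack_univ_lt hpool
  set m : I → ℝ := fun i => κ i / η i with hm
  have hm0 : ∀ i, 0 < m i := fun i => div_pos (hκ i) (hη i)
  have hM : 0 < ∑ i, m i := Finset.sum_pos (fun i _ => hm0 i) Finset.univ_nonempty
  have hC : 0 < N.capacity Finset.univ := Finset.sum_pos (fun j _ => N.cap_pos j) hJ
  have hn0 : ∀ i, 0 ≤ N.balancedFlows ρ m i := fun i =>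
    div_nonneg (mul_nonneg (hρ0 i) hM.le) hδ.le
  have hCRP := completeResourcePooling_balancedFlows hU_concave hU_mono hU_diff hρ0 hm0 hδ hslack
  refine ⟨N.balancedFlows ρ m, m, ⟨hn0, fun i => (hm0 i).le, _,
    -- Pooling at the state itself supplies the optimal allocation required for the equilibrium.
    (hCRP.self_of_nhdsWithin (fun i => add_nonneg (hn0 i) (hm0 i).le) _).mpr rfl,
    fun i => ?_, fun i => ?_⟩, ?_, hCRP⟩
  · have hlam' : lam i = μ i * ρ i := by rw [hρ, mul_div_cancel₀ _ (hμ i).ne']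
    rw [sum_balancedFlows_add_univ N m hδ.ne', balancedFlows, hlam']
    field_simp
    ring
  · rw [hm, mul_div_cancel₀ _ (hη i).ne', sub_self]
  · rintro n' m' ⟨hn', -, x, hx, hn, hm'⟩
    have hmm : m' = m := funext fun i => by
      rw [hm, eq_div_iff (hη i).ne']
      linarith [hm' i]
    subst hmm
    refine ⟨eq_balancedFlows hU_concave hU_mono hU_diff hn' hm0 hδ hslack hx fun i => ?_, rfl⟩
    rw [hρ, eq_div_iff (hμ i).ne']
    linarith [hn i]
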